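/- Let $\mathbb{R}\{\mathbf{x}\}$ be the ring of ordinary differential polynomials in $\mathbf{x}=(x_1,\dots,x_n)$, i.e. the polynomial ring over $\mathbb{R}$ in the derivatives $x_i^{(k)}$ ($1\le i\le n$, $k\ge 0$), where $x_i^{(0)}=x_i$, and $x_i^{(k)}$ is called proper if $k\ge 1$. A polynomial without proper derivatives, i.e. an element of $\mathbb{R}[\mathbf{x}]$, is called nondifferential. Fix a differential ranking, i.e. a well-ordering $<$ of the derivatives such that $x_i^{(k)}<x_i^{(k+1)}$, and such that $x_i^{(k)}<x_j^{(l)}$ implies $x_i^{(k+1)}<x_j^{(l+1)}$. The leader $l_p$ of a nonconstant $p$ is the highest-ranking derivative occurring in $p$, its separant is $\partial p/\partial l_p$, and $q$ is partially reduced with respect to $p$ if no $l_p^{(k)}$ with $k\ge 1$ occurs in $q$. Let $A,S\subseteq\mathbb{R}\{\mathbf{x}\}$ be finite with $0\notin S$. Suppose that $(A=0,S\neq 0)$ is a regular differential system: the elements of $A$ are nonconstant, have pairwise distinct leaders and are pairwise partially reduced; the elements of $S$ are partially reduced with respect to every element of $A$; and $S$ contains the separant of each element of $A$, up to a nonzero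 constant factor (separants that are nonzero constants need not be listed in $S$). Suppose that the system is explicit with nondifferential inequations: every element of $A$ in which a proper derivative occurs is of the form $x_i'+g$ with $1\le i\le n$ and $g\in\mathbb{R}[\mathbf{x}]$, and $S\subseteq\mathbb{R}[\mathbf{x}]$. Suppose finally that for each $i$ at most one polynomial of the form $x_i'+g$ with $g\in\mathbb{R}[\mathbf{x}]$ belongs to $A$ (this is automatic if derivatives of higher order always rank higher). Then $$\bigl((A):S^\infty\bigr)\cap\mathbb{R}[\mathbf{x}]=(A\cap\mathbb{R}[\mathbf{x}]):S^\infty .$$ Here $(A)$ is the ideal of $\mathbb{R}\{\mathbf{x}\}$ generated by $A$, while $(A\cap\mathbb{R}[\mathbf{x}])$ is the ideal of $\mathbb{R}[\mathbf{x}]$ generated by $A\cap\mathbb{R}[\mathbf{x}]$. For an ideal $I$ of either ring, $I:S^\infty$ is the set of all $p$ in that ring such that $sp\in I$ for some finite product $s$ of elements of $S$ (including the empty product $1$). -/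

import Mathlib

namespace DiffAlg

/-- The derivative `x_i^{(k)}` of the `i`-th of `n` differential indeterminates is the pair `(i, k)`;
its derivative is `(i, k + 1)`, and it is proper when `1 ≤ k`. -/
abbrev Deriv (n : ℕ) : Type := Fin n × ℕ

/-- The differential polynomial ring `K{x_1, …, x_n}`: the polynomial ring over `K` in all the
derivatives `x_i^{(k)}`. -/
abbrev DiffPoly (K : Type*) [Field K] (n : ℕ) : Type _ := MvPolynomial (Deriv n) K

/-- The inclusion `K[x_1, …, x_n] ⊆ K{x_1, …, x_n}`, sending `x_i` to `x_i^{(0)}`. -/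
noncomputable def incl (K : Type*) [Field K] (n : ℕ) :
    MvPolynomial (Fin n) K →ₐ[K] DiffPoly K n :=
  MvPolynomial.rename (fun i => (i, 0))

/-- `p ∈ K[x]`: no proper derivative occurs in `p`. -/
def IsNondifferential {K : Type*} [Field K] {n : ℕ} (p : DiffPoly K n) : Prop :=
  ∃ q : MvPolynomial (Fin n) K, incl K n q = p

/-- The explicit differential polynomial `x_i' + q` with `q ∈ K[x]`. -/
noncomputable def explicitPoly {K : Type*} [Field K] {n : ℕ} (i : Fin n)
    (q : MvPolynomial (Fin n) K) : DiffPoly K n :=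
  MvPolynomial.X (i, 1) + incl K n q

/-- `p` is in explicit form: `p = x_i' + q` for some `i` and some nondifferential `q`. -/
def IsExplicit {K : Type*} [Field K] {n : ℕ} (p : DiffPoly K n) : Prop :=
  ∃ (i : Fin n) (q : MvPolynomial (Fin n) K), p = explicitPoly i q

/-- The restriction `A ∩ K[x]`, as a subset of `K[x]`. -/
def restrict {K : Type*} [Field K] {n : ℕ} (A : Set (DiffPoly K n)) :
    Set (MvPolynomial (Fin n) K) :=
  {q | incl K n q ∈ A}

/-- A differential ranking: a well-founded linear order of the derivatives that goes up with
differentiation and respects it. -/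
structure DiffRanking (n : ℕ) where
  /-- `lt u v` means that `v` ranks higher than `u`. -/
  lt : Deriv n → Deriv n → Prop
  isWellOrder : IsWellOrder (Deriv n) lt
  lt_deriv : ∀ (i : Fin n) (k : ℕ), lt (i, k) (i, k + 1)
  deriv_lt_deriv : ∀ (i j : Fin n) (k l : ℕ), lt (i, k) (j, l) → lt (i, k + 1) (j, l + 1)

/-- `v` is the leader of `p`: the highest ranking derivative that occurs in `p`.
Constants have no leader. -/
def IsLeader {K : Type*} [Field K] {n : ℕ} (r : DiffRanking n) (p : DiffPoly K n)
    (v : Deriv n) : Prop :=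
  v ∈ p.vars ∧ ∀ w ∈ p.vars, w ≠ v → r.lt w v

/-- `p` is partially reduced with respect to `q`: no proper derivative of the leader of `q`
occurs in `p`. -/
def IsPartiallyReduced {K : Type*} [Field K] {n : ℕ} (r : DiffRanking n)
    (p q : DiffPoly K n) : Prop :=
  ∀ (i : Fin n) (k : ℕ), IsLeader r q (i, k) → ∀ l : ℕ, k < l → (i, l) ∉ p.vars

/-- `(A = 0, S ≠ 0)` is a regular differential system with respect to the ranking `r`.
In `separant_mem`, the separant `∂p/∂v` of `p` with leader `v` has to belong to `S` only up to a
nonzero constant factor, and a separant that is a nonzero constant need not be listed in `S`. -/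
structure IsRegularDiffSystem {K : Type*} [Field K] {n : ℕ} (r : DiffRanking n)
    (A S : Set (DiffPoly K n)) : Prop where
  finite_left : A.Finite
  finite_right : S.Finite
  zero_notMem : (0 : DiffPoly K n) ∉ S
  partiallyReduced : A.Pairwise (IsPartiallyReduced r)
  exists_leader : ∀ p ∈ A, ∃ v, IsLeader r p v
  leader_injective : ∀ p ∈ A, ∀ q ∈ A, ∀ v, IsLeader r p v → IsLeader r q v → p = q
  partiallyReduced_right : ∀ s ∈ S, ∀ q ∈ A, IsPartiallyReduced r s q
  separant_mem : ∀ p ∈ A, ∀ v, IsLeader r p v → ∃ c : K, c ≠ 0 ∧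
    (MvPolynomial.C c * MvPolynomial.pderiv v p ∈ S ∨ MvPolynomial.pderiv v p = MvPolynomial.C c)

/-- `(A = 0, S ≠ 0)` is explicit with nondifferential inequations: every element of `A` in which a
proper derivative occurs is in explicit form, and every element of `S` is nondifferential. -/
structure IsExplicitSystem {K : Type*} [Field K] {n : ℕ} (A S : Set (DiffPoly K n)) : Prop where
  explicit : ∀ p ∈ A, (∃ v ∈ p.vars, 1 ≤ v.2) → IsExplicit p
  nondifferential : ∀ s ∈ S, IsNondifferential s

/-- The saturation `I : S^∞`: all `p` with `s * p ∈ I` for some finite product `s` of elements of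
`S` (the empty product `1` included). -/
def saturation {R : Type*} [CommRing R] (I : Ideal R) (S : Set R) : Ideal R where
  carrier := {p | ∃ s ∈ Submonoid.closure S, s * p ∈ I}
  zero_mem' := ⟨1, one_mem _, by simp⟩
  add_mem' := by
    rintro a b ⟨s, hs, hsa⟩ ⟨t, ht, htb⟩
    refine ⟨s * t, mul_mem hs ht, ?_⟩
    have h : s * t * (a + b) = t * (s * a) + s * (t * b) := by ring
    rw [h]
    exact I.add_mem (I.mul_mem_left _ hsa) (I.mul_mem_left _ htb)
  smul_mem' := by
    rintro c a ⟨s, hs, hsa⟩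
    refine ⟨s, hs, ?_⟩
    have h : s * (c • a) = c * (s * a) := by rw [smul_eq_mul]; ring
    rw [h]
    exact I.mul_mem_left _ hsa

end DiffAlg

namespace DiffAlg

open MvPolynomial

variable {K : Type*} [Field K] {n : ℕ}

/-! The inclusion of `K[x]` in `K{x}` has a retraction that kills every explicit element of `A`:
send `x_i'` to `-g` when `x_i' + g` lies in `A`. It fixes `S` and the other elements of `A`, all
nondifferential, so it carries a relation `s * p ∈ (A)` with `p` in `K[x]` to `s * p ∈ (A ∩ K[x])`.
This is `IsExplicitSystem.span_le_comap_substDeriv`; `saturation_le_comap` transports the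
saturations. -/

/-- A differential polynomial in which no proper derivative occurs is nondifferential. -/
theorem isNondifferential_of_forall_vars {p : DiffPoly K n} (hp : ∀ v ∈ p.vars, v.2 < 1) :
    IsNondifferential p := by
  refine exists_rename_eq_of_vars_subset_range p (fun i : Fin n => (i, 0))
    (fun i j h => congrArg Prod.fst h) ?_
  rintro ⟨i, k⟩ hv
  exact ⟨i, Prod.ext rfl (Nat.lt_one_iff.mp (hp _ hv)).symm⟩

/-- The substitution `x_i ↦ x_i`, `x_i' ↦ f_i`, `x_i^{(k)} ↦ 0` for `2 ≤ k`. -/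
noncomputable def substDeriv (f : Fin n → MvPolynomial (Fin n) K) :
    DiffPoly K n →ₐ[K] MvPolynomial (Fin n) K :=
  aeval fun v => match v with
    | (i, 0) => X i
    | (i, 1) => f i
    -- Any value would do: orders above one may occur in the cofactors of a relation, but not in the
    -- elements of `A` or `S`.
    | (_, _ + 2) => 0

@[simp]
theorem substDeriv_incl (f : Fin n → MvPolynomial (Fin n) K) (q : MvPolynomial (Fin n) K) :
    substDeriv f (incl K n q) = q := by
  have h : (substDeriv f).comp (incl K n) = AlgHom.id K _ := by
    ext i
    simp [substDeriv, incl]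
  exact DFunLike.congr_fun h q

@[simp]
theorem substDeriv_explicitPoly (f : Fin n → MvPolynomial (Fin n) K) (i : Fin n)
    (g : MvPolynomial (Fin n) K) : substDeriv f (explicitPoly i g) = f i + g := by
  rw [explicitPoly, map_add, substDeriv_incl]
  simp [substDeriv]

/-- If each `x_i'` is the leading term of at most one explicit element of `A`, some substitution
for the `x_i'` annihilates all explicit elements of `A`. -/
theorem exists_substDeriv_explicitPoly_eq_zero {A : Set (DiffPoly K n)}
    (huniq : ∀ (i : Fin n) (g h : MvPolynomial (Fin n) K),
      explicitPoly i g ∈ A → explicitPoly i h ∈ A → g = h) :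
    ∃ f : Fin n → MvPolynomial (Fin n) K,
      ∀ i g, explicitPoly i g ∈ A → substDeriv f (explicitPoly i g) = 0 := by
  have h (i : Fin n) : ∃ f : MvPolynomial (Fin n) K, ∀ g, explicitPoly i g ∈ A → f + g = 0 := by
    by_cases hi : ∃ g, explicitPoly i g ∈ A
    · obtain ⟨g, hg⟩ := hi
      -- By uniqueness, the value that kills one `x_i' + g` kills all of them.
      refine ⟨-g, fun g' hg' => ?_⟩
      rw [huniq i g' g hg' hg, neg_add_cancel]
    · exact ⟨0, fun g hg => (hi ⟨g, hg⟩).elim⟩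
  choose f hf using h
  exact ⟨f, fun i g hg => by rw [substDeriv_explicitPoly, hf i g hg]⟩

theorem IsExplicitSystem.span_le_comap_substDeriv {A S : Set (DiffPoly K n)}
    (hexp : IsExplicitSystem A S) {f : Fin n → MvPolynomial (Fin n) K}
    (hf : ∀ i g, explicitPoly i g ∈ A → substDeriv f (explicitPoly i g) = 0) :
    Ideal.span A ≤ (Ideal.span (restrict A)).comap (substDeriv f) := by
  refine Ideal.span_le.mpr fun p hp => ?_
  change substDeriv f p ∈ Ideal.span (restrict A)
  by_cases hv : ∃ v ∈ p.vars, 1 ≤ v.2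
  · obtain ⟨i, g, rfl⟩ := hexp.explicit p hp hv
    rw [hf i g hp]
    exact zero_mem _
  · push Not at hv
    obtain ⟨q, rfl⟩ := isNondifferential_of_forall_vars hv
    rw [substDeriv_incl]
    exact Ideal.subset_span hp

/-- A ring homomorphism that maps `I` into `J` and `S` into `T` maps `I : S^∞` into `J : T^∞`. -/
theorem saturation_le_comap {R R' : Type*} [CommRing R] [CommRing R'] (φ : R →+* R')
    {I : Ideal R} {J : Ideal R'} {S : Set R} {T : Set R'} (hI : I ≤ J.comap φ)
    (hS : ∀ s ∈ S, φ s ∈ T) : saturation I S ≤ (saturation J T).comap φ := by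
  rintro p ⟨s, hs, hsp⟩
  refine ⟨φ s, ?_, ?_⟩
  · have h : Submonoid.closure S ≤ (Submonoid.closure T).comap φ :=
      Submonoid.closure_le.mpr fun t ht => Submonoid.subset_closure (hS t ht)
    exact h hs
  · rw [← map_mul]
    exact hI hsp

end DiffAlg

theorem lemma3p1 {n : ℕ} (r : DiffAlg.DiffRanking n) (A S : Set (DiffAlg.DiffPoly ℝ n))
    (hreg : DiffAlg.IsRegularDiffSystem r A S)
    (hexp : DiffAlg.IsExplicitSystem A S)
    (huniq : ∀ (i : Fin n) (g h : MvPolynomial (Fin n) ℝ),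
      DiffAlg.explicitPoly i g ∈ A → DiffAlg.explicitPoly i h ∈ A → g = h) :
    Ideal.comap (DiffAlg.incl ℝ n) (DiffAlg.saturation (Ideal.span A) S) =
      DiffAlg.saturation (Ideal.span (DiffAlg.restrict A)) (DiffAlg.restrict S) := by
  obtain ⟨f, hf⟩ := DiffAlg.exists_substDeriv_explicitPoly_eq_zero huniq
  apply le_antisymm
  · intro p hp
    -- Since the substitution is a retraction, it returns `p` itself and sends each `s ∈ S` to its
    -- preimage in `K[x]`.
    have h := DiffAlg.saturation_le_comap (DiffAlg.substDeriv f).toRingHom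
      (T := DiffAlg.restrict S) (hexp.span_le_comap_substDeriv hf)
      (fun s hs => by
        obtain ⟨t, rfl⟩ := hexp.nondifferential s hs
        simpa [DiffAlg.restrict] using hs) hp
    simpa using h
  -- A relation over `K[x]` remains one over `K{x}`.
  · exact DiffAlg.saturation_le_comap (DiffAlg.incl ℝ n).toRingHom
      (Ideal.span_le.mpr fun q hq => Ideal.subset_span hq) fun s hs => hs
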